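/- Let $\mathcal N$ be a quantum channel (a completely positive trace-preserving linear map) from a finite-dimensional system $A$ to a finite-dimensional system $Y$. Let $V:A\to Y\otimes E$ be an isometric extension of $\mathcal N$ with $E$ finite-dimensional, so that $\mathcal N(\rho)=\operatorname{Tr}_E(V\rho V^\dagger)$, and let $\mathcal N^c(\rho)=\operatorname{Tr}_Y(V\rho V^\dagger)$ be the complementary channel. Assume that $\mathcal N$ is degradable, i.e. $\mathcal N^c=\mathcal D\circ\mathcal N$ for some channel $\mathcal D$. Let $H$ be a Hermitian operator on $Y$ (the Hamiltonian). Write $S(\sigma)=-\operatorname{Tr}(\sigma\ln\sigma)$ for the von Neumann entropy. For a finite ensemble $\xi=\{p_x,\rho_x\}$ of states of $A$ with average $\rho=\sum_x p_x\rho_x$, put $$\chi_{Y}(\xi)=S(\mathcal N(\rho))-\sum_x p_x S(\mathcal N(\rho_x)),\qquad \chi_{E}(\xi)=S(\mathcal N^c(\rho))-\sum_x p_x S(\mathcal N^c(\rho_x)).$$ For a real number $B$ let $$P_1^Q(B)=\max\bigl\{\chi_{Y}(\xi)-\chi_{E}(\xi)\;:\;\xi=\{p_x,\rho_x\},\ \operatorname{Tr}(H\mathcal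 N(\rho))\ge B\bigr\},$$ the maximum being over all finite ensembles, that is, over both the signal states (of any finite number) and their probabilities. Then this maximum is attained for every $B$ for which some ensemble satisfies the constraint, and $P_1^Q$ is piecewise concave on the set of all such $B$: there are finitely many breakpoints such that $P_1^Q$ is concave on every interval of such $B$ that has no breakpoint in its interior. -/

import Mathlib

namespace CapacityPower

open scoped ComplexOrder

/-- A density matrix (quantum state) on a finite-dimensional system. -/
def IsDensity {a : Type*} [Fintype a] (ρ : Matrix a a ℂ) : Prop :=
  ρ.PosSemidef ∧ ρ.trace = 1

/-- Amplification `id_n ⊗ Φ` of a linear map on matrices, applied blockwise. -/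
def amplify {a b : Type*} (n : ℕ) (Φ : Matrix a a ℂ →ₗ[ℂ] Matrix b b ℂ)
    (X : Matrix (Fin n × a) (Fin n × a) ℂ) : Matrix (Fin n × b) (Fin n × b) ℂ :=
  Matrix.of fun r s => Φ (Matrix.of fun p q => X (r.1, p) (s.1, q)) r.2 s.2

/-- A quantum channel: a completely positive, trace-preserving linear map. -/
def IsChannel {a b : Type*} [Fintype a] [Fintype b]
    (Φ : Matrix a a ℂ →ₗ[ℂ] Matrix b b ℂ) : Prop :=
  (∀ (n : ℕ) (X : Matrix (Fin n × a) (Fin n × a) ℂ), X.PosSemidef → (amplify n Φ X).PosSemidef) ∧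
    ∀ X : Matrix a a ℂ, (Φ X).trace = X.trace

/-- Partial trace over the second factor (the environment `E`). -/
def traceE {b e : Type*} [Fintype e] (X : Matrix (b × e) (b × e) ℂ) : Matrix b b ℂ :=
  Matrix.of fun i j => ∑ k, X (i, k) (j, k)

/-- Partial trace over the first factor (the receiver `B`). -/
def traceB {b e : Type*} [Fintype b] (X : Matrix (b × e) (b × e) ℂ) : Matrix e e ℂ :=
  Matrix.of fun k l => ∑ i, X (i, k) (i, l)

/-- `Nc` is a complementary channel of `N`: for some isometric extension `V : A → B ⊗ E` of `N`,
`N ρ = Tr_E (V ρ V†)` and `Nc ρ = Tr_B (V ρ V†)`. -/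
def IsComplementary {a b e : Type*} [Fintype a] [DecidableEq a] [Fintype b] [Fintype e]
    (N : Matrix a a ℂ →ₗ[ℂ] Matrix b b ℂ) (Nc : Matrix a a ℂ →ₗ[ℂ] Matrix e e ℂ) : Prop :=
  ∃ V : Matrix (b × e) a ℂ, V.conjTranspose * V = 1 ∧
    (∀ ρ, N ρ = traceE (V * ρ * V.conjTranspose)) ∧
    (∀ ρ, Nc ρ = traceB (V * ρ * V.conjTranspose))

/-- `N`, with complementary channel `Nc`, is degradable: `Nc = D ∘ N` for some channel `D`. -/
def IsDegradable {a b e : Type*} [Fintype b] [Fintype e]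
    (N : Matrix a a ℂ →ₗ[ℂ] Matrix b b ℂ) (Nc : Matrix a a ℂ →ₗ[ℂ] Matrix e e ℂ) : Prop :=
  ∃ D : Matrix b b ℂ →ₗ[ℂ] Matrix e e ℂ, IsChannel D ∧ Nc = D ∘ₗ N

/-- The von Neumann entropy `S(ρ) = -Tr(ρ ln ρ)`, with `0 ln 0 = 0`. -/
noncomputable def entropy {a : Type*} [Fintype a] [DecidableEq a] (ρ : Matrix a a ℂ) : ℝ :=
  -(ρ * cfc Real.log ρ).trace.re

/-- An ensemble `{p_x, ρ_x}` of `m` signal states on the system `a`. -/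
structure Ensemble (a : Type*) [Fintype a] (m : ℕ) where
  p : Fin m → ℝ
  state : Fin m → Matrix a a ℂ
  p_nonneg : ∀ x, 0 ≤ p x
  p_sum : ∑ x, p x = 1
  isDensity : ∀ x, IsDensity (state x)

/-- The averaged input state `∑ₓ pₓ ρₓ`. -/
noncomputable def Ensemble.avg {a : Type*} [Fintype a] {m : ℕ} (ξ : Ensemble a m) :
    Matrix a a ℂ :=
  ∑ x, (ξ.p x : ℂ) • ξ.state x

/-- The Holevo quantity of the output ensemble `{p_x, Φ(ρ_x)}`. -/
noncomputable def holevo {a b : Type*} [Fintype a] [Fintype b] [DecidableEq b]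
    (Φ : Matrix a a ℂ →ₗ[ℂ] Matrix b b ℂ) {m : ℕ} (ξ : Ensemble a m) : ℝ :=
  entropy (Φ ξ.avg) - ∑ x, ξ.p x * entropy (Φ (ξ.state x))

/-- The average received energy `Tr(H N(ρ))`. -/
noncomputable def energy {a b : Type*} [Fintype a] [Fintype b]
    (N : Matrix a a ℂ →ₗ[ℂ] Matrix b b ℂ) (H : Matrix b b ℂ) {m : ℕ} (ξ : Ensemble a m) : ℝ :=
  (H * N ξ.avg).trace.re

/-- The values `χ_AB - χ_AE` over all `B`-admissible ensembles: all finite families of signal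
states, all probabilities, subject to `Tr(H N(ρ)) ≥ B`. -/
def privateRates {a b e : Type*} [Fintype a] [Fintype b] [DecidableEq b] [Fintype e]
    [DecidableEq e] (N : Matrix a a ℂ →ₗ[ℂ] Matrix b b ℂ) (Nc : Matrix a a ℂ →ₗ[ℂ] Matrix e e ℂ)
    (H : Matrix b b ℂ) (B : ℝ) : Set ℝ :=
  {r | ∃ (m : ℕ) (ξ : Ensemble a m), B ≤ energy N H ξ ∧ r = holevo N ξ - holevo Nc ξ}

/-- The single-use private capacity-power function `P₁^Q(B)`. -/
noncomputable def privateCapacityPower {a b e : Type*} [Fintype a] [Fintype b] [DecidableEq b]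
    [Fintype e] [DecidableEq e] (N : Matrix a a ℂ →ₗ[ℂ] Matrix b b ℂ)
    (Nc : Matrix a a ℂ →ₗ[ℂ] Matrix e e ℂ) (H : Matrix b b ℂ) (B : ℝ) : ℝ :=
  sSup (privateRates N Nc H B)

/-- The energy thresholds `B` that some input ensemble meets. -/
def feasible {a b : Type*} [Fintype a] [Fintype b]
    (N : Matrix a a ℂ →ₗ[ℂ] Matrix b b ℂ) (H : Matrix b b ℂ) : Set ℝ :=
  {B | ∃ (m : ℕ) (ξ : Ensemble a m), B ≤ energy N H ξ}

/-- `f` is piecewise concave on `s`: there are finitely many breakpoints such that `f` is concave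
on every interval contained in `s` that has no breakpoint in its interior (so on each closed piece
between consecutive breakpoints). -/
def PiecewiseConcaveOn (s : Set ℝ) (f : ℝ → ℝ) : Prop :=
  ∃ T : Finset ℝ, ∀ I : Set ℝ, I ⊆ s → I.OrdConnected → (∀ t ∈ T, t ∉ interior I) →
    ConcaveOn ℝ I f

end CapacityPower

/-! Write `coherentInfo` for I(ρ) = S(N ρ) − S(Nc ρ). The difference of Holevo quantities of an
ensemble is I at the average minus the average of I over the signals. Pure signals have I = 0,
because the two marginals of a pure state on Y ⊗ E have the same nonzero spectrum. Degradability
makes I concave: the concavity gap is a Holevo quantity at Y minus its image under D, so it is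
nonnegative by data processing. A spectral decomposition of any state into pure states then gives I
≥ 0. So mixed signals cannot help, and the optimum is the maximum of I over states with enough
energy. That set is compact and I is continuous on it, so the maximum is attained
(`privateCapacityPower_spec`). Mixing optimizers for two thresholds gives concavity on every
interval, with no breakpoints at all.

The analytic core is data processing, `IsChannel.holevo_le`, deduced from monotonicity of relative
entropy, `IsChannel.relEntropy_le`. Relative entropy is an integral over s in [0,1] of a kernel
which, up to the factor s and the trace of ρ, is the maximum of the quadratic functional
`resolventForm` over X. The adjoint of a channel turns a trial X for the outputs into a trial Y for
the inputs, and by the Schwarz inequality the functional does not decrease. -/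

set_option linter.unusedSectionVars false

namespace CapacityPower

open scoped ComplexOrder
open Matrix

/-! ### Positivity, adjoints and the Schwarz inequality for channels -/

section Channel

variable {a b : Type*} [Fintype a] [Fintype b] {Φ : Matrix a a ℂ →ₗ[ℂ] Matrix b b ℂ}

/-- A sandwiched block sum of a channel has nonnegative trace. -/
theorem IsChannel.trace_sandwich_nonneg [DecidableEq a] (h : IsChannel Φ) {n : ℕ}
    (L : Fin n → Matrix a a ℂ) (K : Fin n → Matrix b b ℂ) {σ : Matrix a a ℂ} (hσ : σ.PosSemidef) :
    (∑ k, ∑ l, K k * Φ (L k * σ * (L l)ᴴ) * (K l)ᴴ).PosSemidef := by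
  -- The `L k` are stacked into a block column G and the `K k` into a block row F, so the double sum
  -- is F (id ⊗ Φ)(G σ G†) F†.
  let G : Matrix (Fin n × a) a ℂ := Matrix.of fun r j => L r.1 r.2 j
  let F : Matrix b (Fin n × b) ℂ := Matrix.of fun i r => K r.1 i r.2
  have h1 := h.1 n _ (hσ.mul_mul_conjTranspose_same G)
  have h2 := h1.mul_mul_conjTranspose_same F
  convert h2 using 1
  have hblock : ∀ k l, (Matrix.of fun p q => (G * σ * Gᴴ) (k, p) (l, q)) = L k * σ * (L l)ᴴ := by
    intro k l
    ext p q
    simp [G, Matrix.mul_apply]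
  ext i j
  simp only [Matrix.sum_apply, Matrix.mul_apply (M := _ * _) (N := Fᴴ),
    Matrix.mul_apply (M := F), Fintype.sum_prod_type]
  rw [Finset.sum_comm]
  refine Finset.sum_congr rfl fun l _ => ?_
  simp only [Matrix.mul_apply (M := _ * Φ _), Matrix.mul_apply (M := K _)]
  rw [Finset.sum_comm]
  refine Finset.sum_congr rfl fun q _ => ?_
  rw [Finset.sum_mul]
  refine Finset.sum_congr rfl fun k _ => ?_
  simp [F, amplify, hblock]

theorem IsChannel.posSemidef [DecidableEq a] [DecidableEq b] (h : IsChannel Φ) {σ : Matrix a a ℂ}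
    (hσ : σ.PosSemidef) : (Φ σ).PosSemidef := by
  simpa using h.trace_sandwich_nonneg (n := 1) (fun _ => 1) (fun _ => 1) hσ

theorem IsChannel.isDensity [DecidableEq a] [DecidableEq b] (h : IsChannel Φ) {σ : Matrix a a ℂ}
    (hσ : IsDensity σ) : IsDensity (Φ σ) :=
  ⟨h.posSemidef hσ.1, by rw [h.2, hσ.2]⟩

/-- Channels commute with the conjugate transpose. -/
theorem IsChannel.map_conjTranspose [DecidableEq a] [DecidableEq b] (h : IsChannel Φ)
    (A : Matrix a a ℂ) : Φ Aᴴ = (Φ A)ᴴ := by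
  have hp : ∀ B : Matrix a a ℂ, (Φ (B * Bᴴ))ᴴ = Φ (B * Bᴴ) := fun B =>
    (h.posSemidef (posSemidef_self_mul_conjTranspose B)).isHermitian
  -- Polarization: A + A† and i(A − A†) are combinations of matrices B B†, whose images are
  -- Hermitian; together the two identities recover the claim for A.
  have e1 : A + Aᴴ = (1 + A) * (1 + A)ᴴ - 1 * 1ᴴ - A * Aᴴ := by
    simp only [conjTranspose_add, conjTranspose_one, mul_add, add_mul, one_mul, mul_one]
    abel
  have e2 : Complex.I • A - Complex.I • Aᴴ =
      (1 + Complex.I • A) * (1 + Complex.I • A)ᴴ - 1 * 1ᴴ - A * Aᴴ := by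
    simp only [conjTranspose_add, conjTranspose_one, conjTranspose_smul, mul_add, add_mul, one_mul,
      mul_one, smul_mul_assoc, mul_smul_comm, Complex.star_def, Complex.conj_I, neg_smul, smul_add,
      smul_smul, Complex.I_mul_I, one_smul, mul_neg]
    abel
  have f1 : (Φ (A + Aᴴ))ᴴ = Φ (A + Aᴴ) := by
    rw [e1]; simp only [map_sub, conjTranspose_sub, hp]
  have f2 : (Φ (Complex.I • A - Complex.I • Aᴴ))ᴴ = Φ (Complex.I • A - Complex.I • Aᴴ) := by
    rw [e2]; simp only [map_sub, conjTranspose_sub, hp]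
  simp only [map_add, map_sub, map_smul, conjTranspose_add, conjTranspose_sub, conjTranspose_smul,
    Complex.star_def, Complex.conj_I] at f1 f2
  ext i j
  have g1 := congrFun (congrFun f1 i) j
  have g2 := congrFun (congrFun f2 i) j
  simp only [Matrix.add_apply, Matrix.sub_apply, Matrix.smul_apply, smul_eq_mul] at g1 g2
  linear_combination (-1 / 2) * g1 + (Complex.I / 2) * (-1) * g2 - (1 / 2) *
    ((Φ A)ᴴ i j - (Φ Aᴴ)ᴴ i j + Φ A i j - Φ Aᴴ i j) * Complex.I_sq

/-- The Schwarz inequality for the adjoint of a channel, where `Y` is the adjoint applied to `X`. -/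
theorem IsChannel.schwarz [DecidableEq a] [DecidableEq b] (h : IsChannel Φ) {X : Matrix b b ℂ}
    {Y : Matrix a a ℂ} (hXY : ∀ A, (Φ A * Xᴴ).trace = (A * Yᴴ).trace) {σ : Matrix a a ℂ}
    (hσ : σ.PosSemidef) : (σ * (Y * Yᴴ)).trace.re ≤ (Φ σ * (X * Xᴴ)).trace.re := by
  -- With these blocks the trace expands to tr Φ(σ)XX† − 2 Re tr σYY† + tr σYY†, the last term by
  -- trace preservation.
  have h0 := (h.trace_sandwich_nonneg ![1, -Yᴴ] ![Xᴴ, 1] hσ).trace_nonneg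
  have h1 : (Yᴴ * σ) = (σ * Y)ᴴ := by rw [conjTranspose_mul, hσ.isHermitian.eq]
  simp only [Fin.sum_univ_two, Matrix.cons_val_zero, Matrix.cons_val_one, one_mul, mul_one,
    conjTranspose_one, conjTranspose_conjTranspose, conjTranspose_neg, neg_mul, mul_neg, map_neg,
    neg_neg, Matrix.trace_add, Matrix.trace_neg, h.2] at h0
  rw [h1, h.map_conjTranspose] at h0
  have t1 : (Xᴴ * Φ σ * X).trace = (Φ σ * (X * Xᴴ)).trace := by
    rw [mul_assoc, trace_mul_comm, mul_assoc]
  have t2 : (Xᴴ * Φ (σ * Y)).trace = (σ * (Y * Yᴴ)).trace := by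
    rw [trace_mul_comm, hXY, mul_assoc]
  have t3 : ((Φ (σ * Y))ᴴ * X).trace = star (σ * (Y * Yᴴ)).trace := by
    rw [← t2, ← trace_conjTranspose, conjTranspose_mul, conjTranspose_conjTranspose]
  have t4 : ((σ * Y)ᴴ * Y).trace = star (σ * (Y * Yᴴ)).trace := by
    rw [← trace_conjTranspose, conjTranspose_mul, conjTranspose_mul, conjTranspose_mul,
      conjTranspose_conjTranspose, hσ.isHermitian.eq, mul_assoc, trace_mul_comm, mul_assoc,
      mul_assoc, ← mul_assoc Y, trace_mul_comm σ]
  rw [t1, t2, t3, t4] at h0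
  have := (Complex.le_def.1 h0).1
  simp at this
  linarith

/-- The Hilbert-Schmidt adjoint. -/
theorem exists_adjoint [DecidableEq a] (Φ : Matrix a a ℂ →ₗ[ℂ] Matrix b b ℂ) (X : Matrix b b ℂ) :
    ∃ Y : Matrix a a ℂ, ∀ A, (Φ A * Xᴴ).trace = (A * Yᴴ).trace := by
  refine ⟨(Matrix.of fun j i => (Φ (Matrix.single i j 1) * Xᴴ).trace)ᴴ, fun A => ?_⟩
  conv_lhs => rw [Matrix.matrix_eq_sum_single A]
  simp only [map_sum, Finset.sum_mul, trace_sum, conjTranspose_conjTranspose]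
  simp only [Matrix.trace, Matrix.diag, Matrix.mul_apply (M := A), Matrix.of_apply]
  refine Finset.sum_congr rfl fun i _ => Finset.sum_congr rfl fun j _ => ?_
  have : Matrix.single i j (A i j) = A i j • Matrix.single i j (1 : ℂ) := by simp
  rw [this, map_smul, smul_mul_assoc]
  simp [Finset.mul_sum]

/-- Mixing a channel with the completely depolarizing one. -/
theorem IsChannel.depolarize [DecidableEq b] [Nonempty b] (h : IsChannel Φ) {ε : ℝ}
    (h0 : 0 ≤ ε) (h1 : ε ≤ 1) :
    IsChannel (((1 - ε : ℝ) : ℂ) • Φ +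
      ((ε / Fintype.card b : ℝ) : ℂ) • (Matrix.traceLinearMap a ℂ ℂ).smulRight (1 : Matrix b b ℂ)) := by
  constructor
  · intro n X hX
    have e : amplify n (((1 - ε : ℝ) : ℂ) • Φ + ((ε / Fintype.card b : ℝ) : ℂ) •
        (Matrix.traceLinearMap a ℂ ℂ).smulRight (1 : Matrix b b ℂ)) X =
        ((1 - ε : ℝ) : ℂ) • amplify n Φ X + ((ε / Fintype.card b : ℝ) : ℂ) •
          Matrix.kroneckerMap (· * ·) (traceE X) (1 : Matrix b b ℂ) := by
      ext r s
      simp [amplify, traceE, Matrix.trace]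
    rw [e]
    have hT : (traceE X).PosSemidef := by
      have : traceE X = ∑ k, X.submatrix (fun i => (i, k)) (fun i => (i, k)) := by
        ext i j
        simp [traceE, Matrix.sum_apply]
      rw [this]
      exact posSemidef_sum _ fun k _ => hX.submatrix _
    refine PosSemidef.add ((h.1 n X hX).smul ?_) (PosSemidef.smul (hT.kronecker PosSemidef.one) ?_)
    · exact_mod_cast sub_nonneg.2 h1
    · exact_mod_cast (by positivity : 0 ≤ ε / Fintype.card b)
  · intro X
    have : (Fintype.card b : ℂ) ≠ 0 := by simp
    simp [h.2]
    field_simp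
    ring

end Channel

/-! ### Spectral formulas and continuity of the entropy -/

section Entropy

variable {a b : Type*} [Fintype a] [DecidableEq a] [Fintype b] [DecidableEq b]

theorem cfc_eq_conj_diagonal {A : Matrix a a ℂ} (hA : A.IsHermitian) (f : ℝ → ℝ) :
    cfc f A = (hA.eigenvectorUnitary : Matrix a a ℂ) *
      diagonal (fun i => (f (hA.eigenvalues i) : ℂ)) *
        (hA.eigenvectorUnitary : Matrix a a ℂ)ᴴ := by
  rw [hA.cfc_eq]
  rfl

theorem eq_conj_diagonal {A : Matrix a a ℂ} (hA : A.IsHermitian) :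
    A = (hA.eigenvectorUnitary : Matrix a a ℂ) * diagonal (fun i => (hA.eigenvalues i : ℂ)) *
        (hA.eigenvectorUnitary : Matrix a a ℂ)ᴴ :=
  hA.spectral_theorem

theorem eigenvectorUnitary_conjTranspose_mul {A : Matrix a a ℂ} (hA : A.IsHermitian) :
    (hA.eigenvectorUnitary : Matrix a a ℂ)ᴴ * (hA.eigenvectorUnitary : Matrix a a ℂ) = 1 :=
  Unitary.coe_star_mul_self _

theorem eigenvectorUnitary_mul_conjTranspose {A : Matrix a a ℂ} (hA : A.IsHermitian) :
    (hA.eigenvectorUnitary : Matrix a a ℂ) * (hA.eigenvectorUnitary : Matrix a a ℂ)ᴴ = 1 :=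
  Unitary.coe_mul_star_self _

theorem mul_cfc_log {A : Matrix a a ℂ} (hA : A.IsHermitian) :
    A * cfc Real.log A = -cfc Real.negMulLog A := by
  have h := cfc_mul (fun x : ℝ => x) Real.log A continuousOn_id
    (A.finite_real_spectrum.continuousOn _)
  rw [cfc_id' ℝ A hA.isSelfAdjoint] at h
  rw [← h, ← cfc_neg]
  congr 1
  ext x
  simp [Real.negMulLog]

theorem entropy_eq_trace_cfc {A : Matrix a a ℂ} (hA : A.IsHermitian) :
    entropy A = (cfc Real.negMulLog A).trace.re := by
  rw [entropy, mul_cfc_log hA]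
  simp

theorem entropy_eq_sum {A : Matrix a a ℂ} (hA : A.IsHermitian) :
    entropy A = ∑ i, Real.negMulLog (hA.eigenvalues i) := by
  rw [entropy_eq_trace_cfc hA, cfc_eq_conj_diagonal hA, mul_assoc, trace_mul_comm, mul_assoc,
    eigenvectorUnitary_conjTranspose_mul, mul_one]
  simp [trace_diagonal]

/-- The characteristic polynomial allows comparison of matrices of different sizes, and makes
transpose invariance immediate. -/
theorem entropy_eq_roots {A : Matrix a a ℂ} (hA : A.IsHermitian) :
    entropy A = (A.charpoly.roots.map fun z => Real.negMulLog z.re).sum := by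
  rw [entropy_eq_sum hA, hA.roots_charpoly_eq_eigenvalues]
  rw [Multiset.map_map]
  exact Finset.sum_congr rfl fun i _ => by simp

/-- `M M†` and `M† M` have the same entropy. -/
theorem entropy_mul_conjTranspose (M : Matrix a b ℂ) : entropy (M * Mᴴ) = entropy (Mᴴ * M) := by
  -- The two characteristic polynomials agree up to powers of X; the extra zero roots contribute
  -- `negMulLog 0 = 0`.
  have h := congrArg Polynomial.roots (charpoly_mul_comm' M Mᴴ)
  rw [Polynomial.roots_mul (mul_ne_zero (pow_ne_zero _ Polynomial.X_ne_zero)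
      (charpoly_monic _).ne_zero),
    Polynomial.roots_mul (mul_ne_zero (pow_ne_zero _ Polynomial.X_ne_zero)
      (charpoly_monic _).ne_zero), Polynomial.roots_X_pow, Polynomial.roots_X_pow] at h
  have h' := congrArg (fun s : Multiset ℂ => (s.map fun z => Real.negMulLog z.re).sum) h
  simp only [Multiset.map_add, Multiset.sum_add, Multiset.map_nsmul, Multiset.map_singleton,
    Multiset.sum_nsmul, Multiset.sum_singleton, Complex.zero_re, Real.negMulLog_zero, smul_zero,
    zero_add] at h'
  rw [entropy_eq_roots (isHermitian_mul_conjTranspose_self M),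
    entropy_eq_roots (isHermitian_conjTranspose_mul_self M), h']

theorem entropy_transpose {A : Matrix a a ℂ} (hA : A.IsHermitian) : entropy Aᵀ = entropy A := by
  rw [entropy_eq_roots hA, entropy_eq_roots hA.transpose, charpoly_transpose]

theorem IsDensity.sum_eigenvalues {ρ : Matrix a a ℂ} (hρ : IsDensity ρ) :
    ∑ i, hρ.1.isHermitian.eigenvalues i = 1 := by
  have h := hρ.1.isHermitian.trace_eq_sum_eigenvalues
  have h' := h.symm.trans hρ.2
  simpa using congrArg Complex.re h'

theorem IsDensity.spectrum_subset {ρ : Matrix a a ℂ} (hρ : IsDensity ρ) :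
    spectrum ℝ ρ ⊆ Set.Icc 0 1 := by
  rw [hρ.1.isHermitian.spectrum_real_eq_range_eigenvalues]
  rintro _ ⟨i, rfl⟩
  refine ⟨hρ.1.eigenvalues_nonneg i, ?_⟩
  rw [← hρ.sum_eigenvalues]
  exact Finset.single_le_sum (fun j _ => hρ.1.eigenvalues_nonneg j) (Finset.mem_univ i)

section Continuity

open scoped Matrix.Norms.L2Operator

theorem continuousOn_cfc_isDensity {f : ℝ → ℝ} (hf : Continuous f) :
    ContinuousOn (cfc f : Matrix a a ℂ → Matrix a a ℂ) {ρ | IsDensity ρ} :=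
  (continuousOn_cfc (Matrix a a ℂ) (isCompact_Icc (a := (0 : ℝ)) (b := 1)) f hf.continuousOn).mono
    fun _ hρ => ⟨hρ.1.isHermitian.isSelfAdjoint, hρ.spectrum_subset⟩

/-- The density matrices form a compact set. -/
theorem isCompact_isDensity : IsCompact {ρ : Matrix a a ℂ | IsDensity ρ} := by
  have : ProperSpace (Matrix a a ℂ) := FiniteDimensional.proper ℂ _
  refine Metric.isCompact_of_isClosed_isBounded ?_ ?_
  · have h1 : IsClosed {ρ : Matrix a a ℂ | ρ.PosSemidef} := by
      simp only [posSemidef_iff_dotProduct_mulVec, Set.ofPred_and, Set.ofPred_forall]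
      refine (isClosed_eq (by fun_prop) (by fun_prop)).inter (isClosed_iInter fun x => ?_)
      have hc : Continuous fun ρ : Matrix a a ℂ => star x ⬝ᵥ ρ *ᵥ x := by fun_prop
      simp only [Complex.le_def, Set.ofPred_and]
      exact (isClosed_le continuous_const (Complex.continuous_re.comp hc)).inter
        (isClosed_eq continuous_const (Complex.continuous_im.comp hc))
    exact h1.inter (isClosed_eq (by fun_prop) (by fun_prop))
  · refine (Metric.isBounded_closedBall (x := (0 : Matrix a a ℂ)) (r := 1)).subset fun ρ hρ => ?_
    rw [mem_closedBall_zero_iff]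
    have h := hρ.1.isHermitian.isSelfAdjoint
    rw [← cfc_id' ℝ ρ h]
    refine norm_cfc_le zero_le_one fun x hx => ?_
    have := hρ.spectrum_subset hx
    rw [Real.norm_eq_abs, abs_of_nonneg this.1]
    exact this.2

end Continuity

/-- The logarithm is discontinuous at 0, but `negMulLog` is continuous, so continuity of the
functional calculus applies even to singular states. -/
theorem continuousOn_entropy : ContinuousOn (entropy : Matrix a a ℂ → ℝ) {ρ | IsDensity ρ} := by
  have h : ContinuousOn (fun ρ : Matrix a a ℂ => (cfc Real.negMulLog ρ).trace.re)
      {ρ | IsDensity ρ} := by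
    have h1 : Continuous fun ρ : Matrix a a ℂ => ρ.trace.re :=
      Complex.continuous_re.comp (by fun_prop)
    exact h1.comp_continuousOn (continuousOn_cfc_isDensity Real.continuous_negMulLog)
  exact h.congr fun ρ hρ => entropy_eq_trace_cfc hρ.1.isHermitian

end Entropy

/-! ### Integral and variational forms of relative entropy; monotonicity -/

section RelativeEntropy

variable {a b : Type*} [Fintype a] [DecidableEq a] [Fintype b] [DecidableEq b]

/-- The quantum relative entropy `Tr ρ (ln ρ - ln σ)` of positive definite matrices. -/
noncomputable def relEntropy (ρ σ : Matrix a a ℂ) : ℝ :=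
  (ρ * (cfc Real.log ρ - cfc Real.log σ)).trace.re

/-- The quadratic functional whose supremum over `X` is the resolvent form in the integral
representation of the relative entropy. -/
noncomputable def resolventForm (s : ℝ) (ρ σ X : Matrix a a ℂ) : ℝ :=
  2 * (ρ * Xᴴ).trace.re - s * (σ * (X * Xᴴ)).trace.re - (1 - s) * (ρ * (Xᴴ * X)).trace.re

/-- Y is the adjoint of Φ applied to X. The linear term is unchanged; the Schwarz inequality, for X
against σ and for X† against ρ, shrinks both subtracted quadratic terms. -/
theorem IsChannel.exists_resolventForm_le {Φ : Matrix a a ℂ →ₗ[ℂ] Matrix b b ℂ} (h : IsChannel Φ)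
    {ρ σ : Matrix a a ℂ} (hρ : ρ.PosSemidef) (hσ : σ.PosSemidef) {s : ℝ} (hs : s ∈ Set.Icc (0 : ℝ) 1)
    (X : Matrix b b ℂ) : ∃ Y, resolventForm s (Φ ρ) (Φ σ) X ≤ resolventForm s ρ σ Y := by
  obtain ⟨Y, hY⟩ := exists_adjoint Φ X
  refine ⟨Y, ?_⟩
  have hY' : ∀ A, (Φ A * Xᴴᴴ).trace = (A * Yᴴᴴ).trace := by
    intro A
    have := congrArg star (hY Aᴴ)
    rw [← trace_conjTranspose, ← trace_conjTranspose, conjTranspose_mul, conjTranspose_mul,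
      h.map_conjTranspose, conjTranspose_conjTranspose (Φ A), conjTranspose_conjTranspose A] at this
    rw [trace_mul_comm, this, trace_mul_comm]
  have h1 := h.schwarz hY hσ
  have h2 := h.schwarz hY' hρ
  rw [conjTranspose_conjTranspose, conjTranspose_conjTranspose] at h2
  have h3 := congrArg Complex.re (hY ρ)
  have h4 := mul_le_mul_of_nonneg_left h1 hs.1
  have h5 := mul_le_mul_of_nonneg_left h2 (sub_nonneg.2 hs.2)
  unfold resolventForm
  linarith

theorem trace_diagonal_mul_conj (C : Matrix a a ℂ) (f g : a → ℝ) :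
    (diagonal (fun i => (f i : ℂ)) * (Cᴴ * (diagonal (fun i => (g i : ℂ)) * C))).trace =
      ((∑ i, ∑ j, f i * g j * Complex.normSq (C j i) : ℝ) : ℂ) := by
  simp only [Matrix.trace, Matrix.diag, diagonal_mul, Matrix.mul_apply (M := Cᴴ),
    conjTranspose_apply, Finset.mul_sum, Complex.ofReal_sum]
  refine Finset.sum_congr rfl fun i _ => Finset.sum_congr rfl fun j _ => ?_
  push_cast
  rw [← Complex.mul_conj, Complex.star_def]
  ring

theorem trace_conj_diagonal_mul (U W : Matrix a a ℂ) (f g : a → ℝ) :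
    (U * diagonal (fun i => (f i : ℂ)) * Uᴴ * (W * diagonal (fun i => (g i : ℂ)) * Wᴴ)).trace =
      ((∑ i, ∑ j, f i * g j * Complex.normSq ((Wᴴ * U) j i) : ℝ) : ℂ) := by
  rw [← trace_diagonal_mul_conj, conjTranspose_mul, conjTranspose_conjTranspose, mul_assoc,
    mul_assoc, trace_mul_comm]
  simp only [mul_assoc]

theorem sum_normSq_col {C : Matrix a a ℂ} (hC : Cᴴ * C = 1) (i : a) :
    ∑ j, Complex.normSq (C j i) = 1 := by
  have h := congrFun (congrFun hC i) i
  simp only [Matrix.mul_apply, conjTranspose_apply, one_apply_eq, Complex.star_def] at h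
  have : ((∑ j, Complex.normSq (C j i) : ℝ) : ℂ) = 1 := by
    rw [← h, Complex.ofReal_sum]
    exact Finset.sum_congr rfl fun j _ => by rw [mul_comm, Complex.mul_conj]
  exact_mod_cast this

/-- In the two eigenbases the form decouples into scalar problems, one for each entry of Z. -/
theorem resolventForm_conj_diagonal {U W : Matrix a a ℂ} (hU : Uᴴ * U = 1) (hW : Wᴴ * W = 1)
    (l m : a → ℝ) (s : ℝ) (Z : Matrix a a ℂ) :
    resolventForm s (U * diagonal (fun i => (l i : ℂ)) * Uᴴ)
      (W * diagonal (fun i => (m i : ℂ)) * Wᴴ) (W * Z * Uᴴ) =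
      ∑ i, ∑ j, (2 * l i * ((Wᴴ * U) j i * star (Z j i)).re -
        ((1 - s) * l i + s * m j) * Complex.normSq (Z j i)) := by
  have e1 : (U * diagonal (fun i => (l i : ℂ)) * Uᴴ * (W * Z * Uᴴ)ᴴ).trace =
      ∑ i, ∑ j, (l i : ℂ) * ((Wᴴ * U) j i * star (Z j i)) := by
    have : (U * diagonal (fun i => (l i : ℂ)) * Uᴴ * (W * Z * Uᴴ)ᴴ).trace =
        (diagonal (fun i => (l i : ℂ)) * (Zᴴ * (Wᴴ * U))).trace := by
      simp only [conjTranspose_mul, conjTranspose_conjTranspose, mul_assoc]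
      rw [trace_mul_comm]
      simp only [mul_assoc]
      rw [← mul_assoc Uᴴ U, hU, one_mul]
    rw [this]
    simp only [Matrix.trace, Matrix.diag, diagonal_mul, Matrix.mul_apply (M := Zᴴ),
      conjTranspose_apply, Finset.mul_sum]
    exact Finset.sum_congr rfl fun i _ => Finset.sum_congr rfl fun j _ => by ring
  have e2 : (W * diagonal (fun i => (m i : ℂ)) * Wᴴ * (W * Z * Uᴴ * (W * Z * Uᴴ)ᴴ)).trace =
      ((∑ i, ∑ j, 1 * m j * Complex.normSq (Z j i) : ℝ) : ℂ) := by
    rw [← trace_diagonal_mul_conj]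
    simp only [conjTranspose_mul, conjTranspose_conjTranspose, mul_assoc]
    rw [trace_mul_comm]
    simp only [mul_assoc, hW, mul_one]
    rw [← mul_assoc Wᴴ W, hW, one_mul, ← mul_assoc Uᴴ U, hU, one_mul]
    simp only [Complex.ofReal_one, diagonal_one, one_mul]
    rw [← mul_assoc, trace_mul_comm]
  have e3 : (U * diagonal (fun i => (l i : ℂ)) * Uᴴ * ((W * Z * Uᴴ)ᴴ * (W * Z * Uᴴ))).trace =
      ((∑ i, ∑ j, l i * 1 * Complex.normSq (Z j i) : ℝ) : ℂ) := by
    rw [← trace_diagonal_mul_conj]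
    simp only [conjTranspose_mul, conjTranspose_conjTranspose, mul_assoc]
    rw [trace_mul_comm]
    simp only [mul_assoc, hU, mul_one]
    rw [← mul_assoc Uᴴ U, hU, one_mul, ← mul_assoc Wᴴ W, hW, one_mul]
    simp only [Complex.ofReal_one, diagonal_one, one_mul]
  unfold resolventForm
  rw [e1, e2, e3]
  simp only [Complex.re_sum, Complex.ofReal_re, Complex.re_ofReal_mul, Finset.mul_sum,
    ← Finset.sum_sub_distrib]
  refine Finset.sum_congr rfl fun i _ => Finset.sum_congr rfl fun j _ => ?_
  ring

/-- Completing the square in z; the maximizer z = (l/d)c is treated in `two_mul_re_sub_eq`. -/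
theorem two_mul_re_sub_le {d : ℝ} (hd : 0 < d) (l : ℝ) (c z : ℂ) :
    2 * l * (c * star z).re - d * Complex.normSq z ≤ Complex.normSq c * (l ^ 2 / d) := by
  rw [← mul_div_assoc, le_div_iff₀ hd]
  simp only [Complex.normSq_apply, Complex.mul_re, Complex.star_def, Complex.conj_re,
    Complex.conj_im]
  nlinarith [sq_nonneg (l * c.re - d * z.re), sq_nonneg (l * c.im - d * z.im)]

theorem two_mul_re_sub_eq {d : ℝ} (hd : 0 < d) (l : ℝ) (c : ℂ) :
    2 * l * (c * star (((l / d : ℝ) : ℂ) * c)).re - d * Complex.normSq (((l / d : ℝ) : ℂ) * c) =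
      Complex.normSq c * (l ^ 2 / d) := by
  simp only [Complex.normSq_apply, Complex.mul_re, Complex.mul_im, Complex.star_def,
    Complex.conj_re, Complex.conj_im, Complex.ofReal_re, Complex.ofReal_im]
  field_simp
  ring

theorem convexComb_pos {l m s : ℝ} (hl : 0 < l) (hm : 0 < m) (hs : s ∈ Set.Icc (0 : ℝ) 1) :
    0 < (1 - s) * l + s * m := by
  rcases hs.1.eq_or_lt with rfl | h
  · simpa using hl
  · have := mul_nonneg (sub_nonneg.2 hs.2) hl.le
    have := mul_pos h hm
    linarith

theorem integral_scalar_kernel {l m : ℝ} (hl : 0 < l) (hm : 0 < m) :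
    ∫ s in (0 : ℝ)..1, l * (l - m) / ((1 - s) * l + s * m) = l * (Real.log l - Real.log m) := by
  have hpos : ∀ s ∈ Set.uIcc (0 : ℝ) 1, (1 - s) * l + s * m ≠ 0 := by
    intro s hs
    rw [Set.uIcc_of_le zero_le_one] at hs
    exact (convexComb_pos hl hm hs).ne'
  rw [intervalIntegral.integral_eq_sub_of_hasDerivAt
    (f := fun s => -l * Real.log ((1 - s) * l + s * m))]
  · simp; ring
  · intro s hs
    have h1 : HasDerivAt (fun s : ℝ => (1 - s) * l + s * m) (m - l) s := by
      have := (((hasDerivAt_id s).const_sub 1).mul_const l).add ((hasDerivAt_id s).mul_const m)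
      exact this.congr_deriv (by ring)
    exact ((h1.log (hpos s hs)).const_mul (-l)).congr_deriv (by ring)
  · exact ContinuousOn.intervalIntegrable (ContinuousOn.div (by fun_prop) (by fun_prop) hpos)

/-- The overlap of the eigenbases of two Hermitian matrices. -/
noncomputable def overlap {ρ σ : Matrix a a ℂ} (hρ : ρ.IsHermitian) (hσ : σ.IsHermitian) :
    Matrix a a ℂ :=
  (hσ.eigenvectorUnitary : Matrix a a ℂ)ᴴ * (hρ.eigenvectorUnitary : Matrix a a ℂ)

theorem overlap_unitary {ρ σ : Matrix a a ℂ} (hρ : ρ.IsHermitian) (hσ : σ.IsHermitian) :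
    (overlap hρ hσ)ᴴ * overlap hρ hσ = 1 := by
  rw [overlap, conjTranspose_mul, conjTranspose_conjTranspose, mul_assoc,
    ← mul_assoc (hσ.eigenvectorUnitary : Matrix a a ℂ), eigenvectorUnitary_mul_conjTranspose,
    one_mul, eigenvectorUnitary_conjTranspose_mul]

theorem relEntropy_eq_sum {ρ σ : Matrix a a ℂ} (hρ : ρ.IsHermitian) (hσ : σ.IsHermitian) :
    relEntropy ρ σ = ∑ i, ∑ j, Complex.normSq (overlap hρ hσ j i) *
      (hρ.eigenvalues i * (Real.log (hρ.eigenvalues i) - Real.log (hσ.eigenvalues j))) := by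
  have h1 : (ρ * cfc Real.log ρ).trace.re =
      ∑ i, hρ.eigenvalues i * Real.log (hρ.eigenvalues i) := by
    have := entropy_eq_sum hρ
    rw [entropy] at this
    simp only [Real.negMulLog, neg_mul, Finset.sum_neg_distrib] at this
    exact neg_injective this
  have h2 : (ρ * cfc Real.log σ).trace.re = ∑ i, ∑ j, hρ.eigenvalues i *
      Real.log (hσ.eigenvalues j) * Complex.normSq (overlap hρ hσ j i) := by
    conv_lhs => rw [eq_conj_diagonal hρ, cfc_eq_conj_diagonal hσ, trace_conj_diagonal_mul]
    exact Complex.ofReal_re _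
  rw [relEntropy, mul_sub, trace_sub, Complex.sub_re, h1, h2, ← Finset.sum_sub_distrib]
  refine Finset.sum_congr rfl fun i _ => ?_
  have : hρ.eigenvalues i * Real.log (hρ.eigenvalues i) =
      ∑ j, hρ.eigenvalues i * Real.log (hρ.eigenvalues i) * Complex.normSq (overlap hρ hσ j i) := by
    rw [← Finset.mul_sum, sum_normSq_col (overlap_unitary hρ hσ), mul_one]
  rw [this, ← Finset.sum_sub_distrib]
  exact Finset.sum_congr rfl fun j _ => by ring

/-- The integrand in the integral representation of the relative entropy. -/
noncomputable def relEntropyKernel {ρ σ : Matrix a a ℂ} (hρ : ρ.IsHermitian) (hσ : σ.IsHermitian)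
    (s : ℝ) : ℝ :=
  ∑ i, ∑ j, Complex.normSq (overlap hρ hσ j i) *
    (hρ.eigenvalues i * (hρ.eigenvalues i - hσ.eigenvalues j) /
      ((1 - s) * hρ.eigenvalues i + s * hσ.eigenvalues j))

theorem continuousOn_scalar_kernel {l m : ℝ} (hl : 0 < l) (hm : 0 < m) :
    ContinuousOn (fun s : ℝ => l * (l - m) / ((1 - s) * l + s * m)) (Set.Icc 0 1) :=
  ContinuousOn.div (by fun_prop) (by fun_prop) fun _ hs => (convexComb_pos hl hm hs).ne'

theorem continuousOn_relEntropyKernel {ρ σ : Matrix a a ℂ} (hρ : ρ.PosDef) (hσ : σ.PosDef) :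
    ContinuousOn (relEntropyKernel hρ.isHermitian hσ.isHermitian) (Set.Icc 0 1) :=
  continuousOn_finsetSum _ fun i _ => continuousOn_finsetSum _ fun j _ =>
    continuousOn_const.mul (continuousOn_scalar_kernel (hρ.eigenvalues_pos i) (hσ.eigenvalues_pos j))

theorem relEntropy_eq_integral {ρ σ : Matrix a a ℂ} (hρ : ρ.PosDef) (hσ : σ.PosDef) :
    relEntropy ρ σ = ∫ s in (0 : ℝ)..1, relEntropyKernel hρ.isHermitian hσ.isHermitian s := by
  have hint : ∀ i j, IntervalIntegrable (fun s : ℝ =>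
      Complex.normSq (overlap hρ.isHermitian hσ.isHermitian j i) *
        (hρ.isHermitian.eigenvalues i *
          (hρ.isHermitian.eigenvalues i - hσ.isHermitian.eigenvalues j) /
          ((1 - s) * hρ.isHermitian.eigenvalues i + s * hσ.isHermitian.eigenvalues j)))
      MeasureTheory.volume 0 1 := fun i j => by
    refine ContinuousOn.intervalIntegrable ?_
    rw [Set.uIcc_of_le zero_le_one]
    exact continuousOn_const.mul
      (continuousOn_scalar_kernel (hρ.eigenvalues_pos i) (hσ.eigenvalues_pos j))
  have hint' : ∀ i, IntervalIntegrable (fun s : ℝ => ∑ j,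
      Complex.normSq (overlap hρ.isHermitian hσ.isHermitian j i) *
        (hρ.isHermitian.eigenvalues i *
          (hρ.isHermitian.eigenvalues i - hσ.isHermitian.eigenvalues j) /
          ((1 - s) * hρ.isHermitian.eigenvalues i + s * hσ.isHermitian.eigenvalues j)))
      MeasureTheory.volume 0 1 := fun i => by
    have := IntervalIntegrable.sum Finset.univ fun j _ => hint i j
    simpa only [Finset.sum_fn] using this
  rw [relEntropy_eq_sum hρ.isHermitian hσ.isHermitian]
  unfold relEntropyKernel
  rw [intervalIntegral.integral_finsetSum fun i _ => hint' i]
  refine Finset.sum_congr rfl fun i _ => ?_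
  rw [intervalIntegral.integral_finsetSum fun j _ => hint i j]
  refine Finset.sum_congr rfl fun j _ => ?_
  rw [intervalIntegral.integral_const_mul,
    integral_scalar_kernel (hρ.eigenvalues_pos i) (hσ.eigenvalues_pos j)]

/-- The denominator d satisfies s(l − m) + d = l. This links the integrand to the scalar maximum
l²/d. -/
theorem scalar_kernel_identity (c : ℝ) {l m s : ℝ} (h : (1 - s) * l + s * m ≠ 0) :
    s * (c * (l * (l - m) / ((1 - s) * l + s * m))) + l * c =
      c * (l ^ 2 / ((1 - s) * l + s * m)) := by
  obtain ⟨d, hd⟩ : ∃ d, d = (1 - s) * l + s * m := ⟨_, rfl⟩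
  rw [← hd] at h ⊢
  field_simp
  rw [hd]
  ring

theorem mul_relEntropyKernel {ρ σ : Matrix a a ℂ} (hρ : ρ.PosDef) (hσ : σ.PosDef) {s : ℝ}
    (hs : s ∈ Set.Icc (0 : ℝ) 1) :
    s * relEntropyKernel hρ.isHermitian hσ.isHermitian s + ρ.trace.re =
      ∑ i, ∑ j, Complex.normSq (overlap hρ.isHermitian hσ.isHermitian j i) *
        (hρ.isHermitian.eigenvalues i ^ 2 /
          ((1 - s) * hρ.isHermitian.eigenvalues i + s * hσ.isHermitian.eigenvalues j)) := by
  have ht : ρ.trace.re = ∑ i, ∑ j, hρ.isHermitian.eigenvalues i *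
      Complex.normSq (overlap hρ.isHermitian hσ.isHermitian j i) := by
    simp_rw [← Finset.mul_sum, sum_normSq_col (overlap_unitary hρ.isHermitian hσ.isHermitian),
      mul_one]
    rw [hρ.isHermitian.trace_eq_sum_eigenvalues]
    simp
  rw [ht, relEntropyKernel, Finset.mul_sum, ← Finset.sum_add_distrib]
  refine Finset.sum_congr rfl fun i _ => ?_
  rw [Finset.mul_sum, ← Finset.sum_add_distrib]
  refine Finset.sum_congr rfl fun j _ => ?_
  exact scalar_kernel_identity _ (convexComb_pos (hρ.eigenvalues_pos i) (hσ.eigenvalues_pos j) hs).ne'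

theorem resolventForm_le {ρ σ : Matrix a a ℂ} (hρ : ρ.PosDef) (hσ : σ.PosDef) {s : ℝ}
    (hs : s ∈ Set.Icc (0 : ℝ) 1) (X : Matrix a a ℂ) :
    resolventForm s ρ σ X ≤
      s * relEntropyKernel hρ.isHermitian hσ.isHermitian s + ρ.trace.re := by
  rw [mul_relEntropyKernel hρ hσ hs]
  set U := (hρ.isHermitian.eigenvectorUnitary : Matrix a a ℂ) with hU
  set W := (hσ.isHermitian.eigenvectorUnitary : Matrix a a ℂ) with hW
  have hX : X = W * (Wᴴ * X * U) * Uᴴ := by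
    have h1 := eigenvectorUnitary_mul_conjTranspose hρ.isHermitian
    have h2 := eigenvectorUnitary_mul_conjTranspose hσ.isHermitian
    rw [← hU] at h1
    rw [← hW] at h2
    simp only [mul_assoc, h1, mul_one]
    rw [← mul_assoc, h2, one_mul]
  have := resolventForm_conj_diagonal (eigenvectorUnitary_conjTranspose_mul hρ.isHermitian)
    (eigenvectorUnitary_conjTranspose_mul hσ.isHermitian) hρ.isHermitian.eigenvalues
    hσ.isHermitian.eigenvalues s (Wᴴ * X * U)
  rw [← eq_conj_diagonal, ← eq_conj_diagonal, ← hU, ← hW, ← hX] at this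
  rw [this]
  refine Finset.sum_le_sum fun i _ => Finset.sum_le_sum fun j _ => ?_
  exact two_mul_re_sub_le (convexComb_pos (hρ.eigenvalues_pos i) (hσ.eigenvalues_pos j) hs) _ _ _

theorem exists_resolventForm_eq {ρ σ : Matrix a a ℂ} (hρ : ρ.PosDef) (hσ : σ.PosDef) {s : ℝ}
    (hs : s ∈ Set.Icc (0 : ℝ) 1) : ∃ X, resolventForm s ρ σ X =
      s * relEntropyKernel hρ.isHermitian hσ.isHermitian s + ρ.trace.re := by
  rw [mul_relEntropyKernel hρ hσ hs]
  let l := hρ.isHermitian.eigenvalues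
  let m := hσ.isHermitian.eigenvalues
  have := resolventForm_conj_diagonal (eigenvectorUnitary_conjTranspose_mul hρ.isHermitian)
    (eigenvectorUnitary_conjTranspose_mul hσ.isHermitian) l m s
    (Matrix.of fun j i => ((l i / ((1 - s) * l i + s * m j) : ℝ) : ℂ) *
      overlap hρ.isHermitian hσ.isHermitian j i)
  rw [← eq_conj_diagonal, ← eq_conj_diagonal] at this
  refine ⟨_, this.trans ?_⟩
  refine Finset.sum_congr rfl fun i _ => Finset.sum_congr rfl fun j _ => ?_
  exact two_mul_re_sub_eq (convexComb_pos (hρ.eigenvalues_pos i) (hσ.eigenvalues_pos j) hs) _ _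

/-- Monotonicity of the relative entropy under channels. -/
theorem IsChannel.relEntropy_le {Φ : Matrix a a ℂ →ₗ[ℂ] Matrix b b ℂ} (h : IsChannel Φ)
    {ρ σ : Matrix a a ℂ} (hρ : ρ.PosDef) (hσ : σ.PosDef) (hρ' : (Φ ρ).PosDef)
    (hσ' : (Φ σ).PosDef) : relEntropy (Φ ρ) (Φ σ) ≤ relEntropy ρ σ := by
  rw [relEntropy_eq_integral hρ hσ, relEntropy_eq_integral hρ' hσ']
  -- The open interval suffices, and s > 0 is needed to cancel s from the comparison of maxima.
  refine intervalIntegral.integral_mono_on_of_le_Ioo zero_le_one ?_ ?_ fun s hs => ?_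
  · exact ContinuousOn.intervalIntegrable_of_Icc zero_le_one (continuousOn_relEntropyKernel hρ' hσ')
  · exact ContinuousOn.intervalIntegrable_of_Icc zero_le_one (continuousOn_relEntropyKernel hρ hσ)
  · have hs' := Set.Ioo_subset_Icc_self hs
    obtain ⟨X, hX⟩ := exists_resolventForm_eq hρ' hσ' hs'
    obtain ⟨Y, hY⟩ := h.exists_resolventForm_le hρ.posSemidef hσ.posSemidef hs' X
    have := resolventForm_le hρ hσ hs' Y
    rw [hX, h.2] at hY
    exact le_of_mul_le_mul_left (by linarith) hs.1

end RelativeEntropy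

/-! ### Data processing for the Holevo quantity -/

section DataProcessing

variable {a b ι : Type*} [Fintype a] [DecidableEq a] [Fintype b] [DecidableEq b] [Fintype ι]

theorem IsDensity.nonempty {ρ : Matrix a a ℂ} (hρ : IsDensity ρ) : Nonempty a := by
  by_contra h
  rw [not_nonempty_iff] at h
  simpa [Matrix.trace] using hρ.2

theorem IsDensity.sum_smul {p : ι → ℝ} (hp : ∀ x, 0 ≤ p x) (hsum : ∑ x, p x = 1)
    {σ : ι → Matrix a a ℂ} (hσ : ∀ x, IsDensity (σ x)) : IsDensity (∑ x, (p x : ℂ) • σ x) := by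
  refine ⟨posSemidef_sum _ fun x _ => (hσ x).1.smul (by exact_mod_cast hp x), ?_⟩
  simp only [trace_sum, trace_smul, (hσ _).2, smul_eq_mul, mul_one]
  exact_mod_cast hsum

/-- The sum `∑ₓ pₓ S(σₓ ‖ σ̄)` is the Holevo quantity. -/
theorem sum_relEntropy (p : ι → ℝ) (σ : ι → Matrix a a ℂ) :
    ∑ x, p x * relEntropy (σ x) (∑ y, (p y : ℂ) • σ y) =
      entropy (∑ y, (p y : ℂ) • σ y) - ∑ x, p x * entropy (σ x) := by
  have h : ∑ x, p x * (σ x * cfc Real.log (∑ y, (p y : ℂ) • σ y)).trace.re =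
      -entropy (∑ y, (p y : ℂ) • σ y) := by
    rw [entropy, neg_neg]
    generalize cfc Real.log (∑ y, (p y : ℂ) • σ y) = L
    simp [Finset.sum_mul, trace_sum]
  simp only [relEntropy, mul_sub, trace_sub, Complex.sub_re, Finset.sum_sub_distrib, h]
  simp only [entropy, mul_neg, Finset.sum_neg_distrib]
  ring

/-- The mixture of a matrix with the maximally mixed state. -/
noncomputable def depolarized (ε : ℝ) (σ : Matrix a a ℂ) : Matrix a a ℂ :=
  ((1 - ε : ℝ) : ℂ) • σ + ((ε / Fintype.card a : ℝ) : ℂ) • 1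

theorem depolarized_zero (σ : Matrix a a ℂ) : depolarized 0 σ = σ := by
  simp [depolarized]

theorem IsDensity.depolarized {σ : Matrix a a ℂ} (hσ : IsDensity σ) {ε : ℝ} (h0 : 0 ≤ ε)
    (h1 : ε ≤ 1) : IsDensity (depolarized ε σ) := by
  have := hσ.nonempty
  refine ⟨(hσ.1.smul ?_).add (PosSemidef.one.smul ?_), ?_⟩
  · exact_mod_cast sub_nonneg.2 h1
  · exact_mod_cast (by positivity : 0 ≤ ε / Fintype.card a)
  · have : (Fintype.card a : ℂ) ≠ 0 := by simp
    simp only [CapacityPower.depolarized, trace_add, trace_smul, hσ.2, trace_one, smul_eq_mul]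
    push_cast
    field_simp
    ring

theorem IsDensity.posDef_depolarized {σ : Matrix a a ℂ} (hσ : IsDensity σ) {ε : ℝ} (h0 : 0 < ε)
    (h1 : ε ≤ 1) : (CapacityPower.depolarized ε σ).PosDef := by
  have := hσ.nonempty
  refine PosDef.posSemidef_add (hσ.1.smul ?_) (PosDef.one.smul ?_)
  · exact_mod_cast sub_nonneg.2 h1
  · exact_mod_cast (by positivity : 0 < ε / Fintype.card a)

theorem depolarized_sum (ε : ℝ) {p : ι → ℝ} (hsum : ∑ x, p x = 1) (σ : ι → Matrix a a ℂ) :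
    depolarized ε (∑ x, (p x : ℂ) • σ x) = ∑ x, (p x : ℂ) • depolarized ε (σ x) := by
  have h : ∑ x, (p x : ℂ) = 1 := by exact_mod_cast hsum
  simp only [depolarized, smul_add, Finset.sum_add_distrib, Finset.smul_sum, ← Finset.sum_smul, h,
    one_smul, smul_comm (p _ : ℂ) ((1 - ε : ℝ) : ℂ)]

theorem continuous_depolarized {f : ℝ → Matrix a a ℂ} (hf : Continuous f) :
    Continuous fun ε => depolarized ε (f ε) := by
  have h1 : Continuous fun ε : ℝ => ((1 - ε : ℝ) : ℂ) := by fun_prop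
  have h2 : Continuous fun ε : ℝ => ((ε / Fintype.card a : ℝ) : ℂ) := by fun_prop
  exact (h1.smul hf).add (h2.smul continuous_const)

theorem holevo_le_of_posDef {D : Matrix a a ℂ →ₗ[ℂ] Matrix b b ℂ} (hD : IsChannel D) {p : ι → ℝ}
    (hp : ∀ x, 0 ≤ p x) {σ : ι → Matrix a a ℂ} (hσ : ∀ x, (σ x).PosDef)
    (hσ' : ∀ x, (D (σ x)).PosDef) (havg : (∑ x, (p x : ℂ) • σ x).PosDef)
    (havg' : (D (∑ x, (p x : ℂ) • σ x)).PosDef) :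
    entropy (D (∑ x, (p x : ℂ) • σ x)) - ∑ x, p x * entropy (D (σ x)) ≤
      entropy (∑ x, (p x : ℂ) • σ x) - ∑ x, p x * entropy (σ x) := by
  rw [← sum_relEntropy]
  have e : D (∑ x, (p x : ℂ) • σ x) = ∑ x, (p x : ℂ) • D (σ x) := by simp
  rw [e, ← sum_relEntropy p fun x => D (σ x), ← e]
  exact Finset.sum_le_sum fun x _ =>
    mul_le_mul_of_nonneg_left (hD.relEntropy_le (hσ x) havg (hσ' x) havg') (hp x)

/-- Data processing for the Holevo quantity. -/
theorem IsChannel.holevo_le {D : Matrix a a ℂ →ₗ[ℂ] Matrix b b ℂ} (hD : IsChannel D) {p : ι → ℝ}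
    (hp : ∀ x, 0 ≤ p x) (hsum : ∑ x, p x = 1) {σ : ι → Matrix a a ℂ} (hσ : ∀ x, IsDensity (σ x)) :
    entropy (D (∑ x, (p x : ℂ) • σ x)) - ∑ x, p x * entropy (D (σ x)) ≤
      entropy (∑ x, (p x : ℂ) • σ x) - ∑ x, p x * entropy (σ x) := by
  have havg := IsDensity.sum_smul hp hsum hσ
  have hDc : Continuous D := LinearMap.continuous_of_finiteDimensional D
  have hc1 : ∀ τ : Matrix a a ℂ, IsDensity τ →
      ContinuousOn (fun ε => entropy (depolarized ε τ)) (Set.Icc 0 1) := fun τ hτ =>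
    continuousOn_entropy.comp (continuous_depolarized continuous_const).continuousOn
      fun ε hε => hτ.depolarized hε.1 hε.2
  have hc2 : ∀ τ : Matrix a a ℂ, IsDensity τ →
      ContinuousOn (fun ε => entropy (depolarized ε (D (depolarized ε τ)))) (Set.Icc 0 1) :=
    fun τ hτ => continuousOn_entropy.comp
      (continuous_depolarized (hDc.comp (continuous_depolarized continuous_const))).continuousOn
      fun ε hε => (hD.isDensity (hτ.depolarized hε.1 hε.2)).depolarized hε.1 hε.2
  -- Noise at the input makes all states definite; noise at the output, absorbed into the channel
  -- `Dε`, does the same for the images. Continuity of entropy then lets ε tend to 0.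
  have key : ∀ ε ∈ Set.Ioc (0 : ℝ) 1,
      entropy (depolarized ε (D (depolarized ε (∑ x, (p x : ℂ) • σ x)))) -
        ∑ x, p x * entropy (depolarized ε (D (depolarized ε (σ x)))) ≤
      entropy (depolarized ε (∑ x, (p x : ℂ) • σ x)) -
        ∑ x, p x * entropy (depolarized ε (σ x)) := by
    intro ε hε
    have hne : Nonempty b := (hD.isDensity havg).nonempty
    have hDε := hD.depolarize hε.1.le hε.2
    set Dε := ((1 - ε : ℝ) : ℂ) • D +
      ((ε / Fintype.card b : ℝ) : ℂ) • (Matrix.traceLinearMap a ℂ ℂ).smulRight (1 : Matrix b b ℂ)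
    have hval : ∀ τ, IsDensity τ → Dε (depolarized ε τ) = depolarized ε (D (depolarized ε τ)) := by
      intro τ hτ
      have := (hτ.depolarized hε.1.le hε.2).2
      simp only [Dε, LinearMap.add_apply, LinearMap.smul_apply, LinearMap.smulRight_apply,
        traceLinearMap_apply, this, one_smul]
      rfl
    have hpd : ∀ τ, IsDensity τ → (Dε (depolarized ε τ)).PosDef := fun τ hτ => by
      rw [hval τ hτ]
      exact (hD.isDensity (hτ.depolarized hε.1.le hε.2)).posDef_depolarized hε.1 hε.2
    have := holevo_le_of_posDef hDε hp (σ := fun x => depolarized ε (σ x))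
      (fun x => (hσ x).posDef_depolarized hε.1 hε.2) (fun x => hpd _ (hσ x))
      (by rw [← depolarized_sum ε hsum]; exact havg.posDef_depolarized hε.1 hε.2)
      (by rw [← depolarized_sum ε hsum]; exact hpd _ havg)
    rw [← depolarized_sum ε hsum, hval _ havg] at this
    simpa only [hval _ (hσ _)] using this
  have hF : ContinuousOn (fun ε =>
      entropy (depolarized ε (D (depolarized ε (∑ x, (p x : ℂ) • σ x)))) -
        ∑ x, p x * entropy (depolarized ε (D (depolarized ε (σ x))))) (Set.Icc 0 1) :=
    (hc2 _ havg).sub (continuousOn_finsetSum _ fun x _ => continuousOn_const.mul (hc2 _ (hσ x)))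
  have hG : ContinuousOn (fun ε => entropy (depolarized ε (∑ x, (p x : ℂ) • σ x)) -
        ∑ x, p x * entropy (depolarized ε (σ x))) (Set.Icc 0 1) :=
    (hc1 _ havg).sub (continuousOn_finsetSum _ fun x _ => continuousOn_const.mul (hc1 _ (hσ x)))
  have h0 : (0 : ℝ) ∈ Set.Icc (0 : ℝ) 1 := by simp
  have hcl : (0 : ℝ) ∈ closure (Set.Ioc (0 : ℝ) 1) := by simp [closure_Ioc]
  have := ContinuousWithinAt.closure_le hcl ((hF 0 h0).mono Set.Ioc_subset_Icc_self)
    ((hG 0 h0).mono Set.Ioc_subset_Icc_self) key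
  simpa only [depolarized_zero] using this

end DataProcessing

/-! ### Concavity of coherent information and the capacity-power function -/

section CoherentInformation

variable {a b e : Type*} [Fintype a] [DecidableEq a] [Fintype b] [DecidableEq b] [Fintype e]
  [DecidableEq e] {N : Matrix a a ℂ →ₗ[ℂ] Matrix b b ℂ} {Nc : Matrix a a ℂ →ₗ[ℂ] Matrix e e ℂ}

/-- The coherent information of a state. -/
noncomputable def coherentInfo (N : Matrix a a ℂ →ₗ[ℂ] Matrix b b ℂ)
    (Nc : Matrix a a ℂ →ₗ[ℂ] Matrix e e ℂ) (ρ : Matrix a a ℂ) : ℝ :=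
  entropy (N ρ) - entropy (Nc ρ)

theorem holevo_sub_holevo {m : ℕ} (ξ : Ensemble a m) : holevo N ξ - holevo Nc ξ =
    coherentInfo N Nc ξ.avg - ∑ x, ξ.p x * coherentInfo N Nc (ξ.state x) := by
  simp only [holevo, coherentInfo, mul_sub, Finset.sum_sub_distrib]
  ring

theorem Ensemble.isDensity_avg {m : ℕ} (ξ : Ensemble a m) : IsDensity ξ.avg :=
  IsDensity.sum_smul ξ.p_nonneg ξ.p_sum ξ.isDensity

/-- The coherent information of a degradable channel is concave. -/
theorem IsDegradable.coherentInfo_concave (hdeg : IsDegradable N Nc) (hN : IsChannel N)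
    {ι : Type*} [Fintype ι] {p : ι → ℝ} (hp : ∀ x, 0 ≤ p x) (hsum : ∑ x, p x = 1)
    {ρ : ι → Matrix a a ℂ} (hρ : ∀ x, IsDensity (ρ x)) :
    ∑ x, p x * coherentInfo N Nc (ρ x) ≤ coherentInfo N Nc (∑ x, (p x : ℂ) • ρ x) := by
  obtain ⟨D, hD, rfl⟩ := hdeg
  have h := hD.holevo_le hp hsum fun x => hN.isDensity (hρ x)
  have e : ∑ x, (p x : ℂ) • N (ρ x) = N (∑ x, (p x : ℂ) • ρ x) := by simp
  rw [e] at h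
  simp only [coherentInfo, LinearMap.comp_apply, mul_sub, Finset.sum_sub_distrib]
  linarith

/-- Both outputs of an isometric extension have the same entropy on a pure input. -/
theorem IsComplementary.coherentInfo_pure (h : IsComplementary N Nc) (ψ : a → ℂ) :
    coherentInfo N Nc (vecMulVec ψ (star ψ)) = 0 := by
  obtain ⟨V, -, h1, h2⟩ := h
  have hV : V * vecMulVec ψ (star ψ) * Vᴴ = vecMulVec (V *ᵥ ψ) (star (V *ᵥ ψ)) := by
    rw [mul_vecMulVec, vecMulVec_mul, star_mulVec]
  -- The vector Vψ reshaped as a matrix, as for the Schmidt decomposition: its marginals are M M†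
  -- and (M† M)ᵀ.
  let M : Matrix b e ℂ := Matrix.of fun i k => (V *ᵥ ψ) (i, k)
  have e1 : N (vecMulVec ψ (star ψ)) = M * Mᴴ := by
    rw [h1, hV]
    ext i j
    simp [traceE, vecMulVec_apply, Matrix.mul_apply, M]
  have e2 : Nc (vecMulVec ψ (star ψ)) = (Mᴴ * M)ᵀ := by
    rw [h2, hV]
    ext i j
    simp [traceB, vecMulVec_apply, Matrix.mul_apply, M, mul_comm]
  rw [coherentInfo, e1, e2, entropy_transpose (isHermitian_conjTranspose_mul_self M),
    entropy_mul_conjTranspose, sub_self]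

/-- Every state is the average of an ensemble of pure states. -/
theorem IsDensity.exists_pure_ensemble {ρ : Matrix a a ℂ} (hρ : IsDensity ρ) :
    ∃ (m : ℕ) (ξ : Ensemble a m), ξ.avg = ρ ∧
      ∀ x, ∃ ψ : a → ℂ, ξ.state x = vecMulVec ψ (star ψ) := by
  have hH := hρ.1.isHermitian
  let U := (hH.eigenvectorUnitary : Matrix a a ℂ)
  let ψ : a → a → ℂ := fun i p => U p i
  let f := (Fintype.equivFin a).symm
  refine ⟨Fintype.card a, ⟨fun x => hH.eigenvalues (f x), fun x => vecMulVec (ψ (f x))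
    (star (ψ (f x))), fun x => hρ.1.eigenvalues_nonneg _, ?_, fun x => ⟨?_, ?_⟩⟩, ?_,
    fun x => ⟨_, rfl⟩⟩
  · rw [f.sum_comp hH.eigenvalues]
    exact hρ.sum_eigenvalues
  · exact posSemidef_vecMulVec_self_star _
  · have := congrFun (congrFun (eigenvectorUnitary_conjTranspose_mul hH) (f x)) (f x)
    rw [Matrix.mul_apply, one_apply_eq] at this
    rw [← this]
    exact Finset.sum_congr rfl fun p _ => by simp [vecMulVec_apply, ψ, U, mul_comm]
  · rw [Ensemble.avg]
    rw [f.sum_comp fun i => (hH.eigenvalues i : ℂ) • vecMulVec (ψ i) (star (ψ i))]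
    conv_rhs => rw [eq_conj_diagonal hH]
    ext p q
    simp only [Matrix.sum_apply, Matrix.smul_apply, vecMulVec_apply, Matrix.mul_apply (N := _ᴴ),
      mul_diagonal, conjTranspose_apply, smul_eq_mul, Pi.star_apply]
    exact Finset.sum_congr rfl fun i _ => by simp only [ψ, U]; ring

/-- The states that meet the energy threshold `B`. -/
def admissibleStates (N : Matrix a a ℂ →ₗ[ℂ] Matrix b b ℂ) (H : Matrix b b ℂ) (B : ℝ) :
    Set (Matrix a a ℂ) :=
  {ρ | IsDensity ρ ∧ B ≤ (H * N ρ).trace.re}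

theorem continuous_trace_mul_re (N : Matrix a a ℂ →ₗ[ℂ] Matrix b b ℂ) (H : Matrix b b ℂ) :
    Continuous fun ρ => (H * N ρ).trace.re := by
  have hN : Continuous N := LinearMap.continuous_of_finiteDimensional N
  exact Complex.continuous_re.comp ((continuous_const.matrix_mul hN).matrix_trace)

theorem isCompact_admissibleStates (N : Matrix a a ℂ →ₗ[ℂ] Matrix b b ℂ) (H : Matrix b b ℂ)
    (B : ℝ) : IsCompact (admissibleStates N H B) :=
  isCompact_isDensity.inter_right (isClosed_le continuous_const (continuous_trace_mul_re N H))

theorem continuousOn_coherentInfo (hN : IsChannel N) (hdeg : IsDegradable N Nc) :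
    ContinuousOn (coherentInfo N Nc) {ρ | IsDensity ρ} := by
  obtain ⟨D, hD, rfl⟩ := hdeg
  have h1 : Continuous N := LinearMap.continuous_of_finiteDimensional N
  have h2 : Continuous (D ∘ₗ N) := LinearMap.continuous_of_finiteDimensional _
  exact (continuousOn_entropy.comp h1.continuousOn fun ρ hρ => hN.isDensity hρ).sub
    (continuousOn_entropy.comp h2.continuousOn fun ρ hρ => hD.isDensity (hN.isDensity hρ))

/-- The private capacity-power function is a maximum of the coherent information. -/
theorem privateCapacityPower_spec (hN : IsChannel N) (hNc : IsComplementary N Nc)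
    (hdeg : IsDegradable N Nc) (H : Matrix b b ℂ) {B : ℝ} (hB : B ∈ feasible N H) :
    IsGreatest (privateRates N Nc H B) (privateCapacityPower N Nc H B) ∧
      ∃ ρ ∈ admissibleStates N H B, privateCapacityPower N Nc H B = coherentInfo N Nc ρ ∧
        ∀ ρ' ∈ admissibleStates N H B, coherentInfo N Nc ρ' ≤ privateCapacityPower N Nc H B := by
  have hne : (admissibleStates N H B).Nonempty := by
    obtain ⟨m, ξ, hξ⟩ := hB
    exact ⟨ξ.avg, ξ.isDensity_avg, hξ⟩
  obtain ⟨ρ, hρ, hmax⟩ := (isCompact_admissibleStates N H B).exists_isMaxOn hne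
    ((continuousOn_coherentInfo hN hdeg).mono fun _ h => h.1)
  have hnonneg : ∀ τ, IsDensity τ → 0 ≤ coherentInfo N Nc τ := by
    intro τ hτ
    obtain ⟨m, ξ, rfl, hpure⟩ := hτ.exists_pure_ensemble
    have := hdeg.coherentInfo_concave hN ξ.p_nonneg ξ.p_sum ξ.isDensity
    refine le_trans (Finset.sum_nonneg fun x _ => ?_) this
    obtain ⟨ψ, hψ⟩ := hpure x
    rw [hψ, hNc.coherentInfo_pure, mul_zero]
  have hgreatest : IsGreatest (privateRates N Nc H B) (coherentInfo N Nc ρ) := by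
    constructor
    -- A pure decomposition of the maximizer keeps the energy, which depends only on the average,
    -- and makes the subtracted sum vanish.
    · obtain ⟨m, ξ, hξ, hpure⟩ := hρ.1.exists_pure_ensemble
      refine ⟨m, ξ, ?_, ?_⟩
      · rw [energy, hξ]
        exact hρ.2
      · rw [holevo_sub_holevo, hξ, Finset.sum_eq_zero, sub_zero]
        intro x _
        obtain ⟨ψ, hψ⟩ := hpure x
        rw [hψ, hNc.coherentInfo_pure, mul_zero]
    · rintro r ⟨m, ξ, hξ, rfl⟩
      rw [holevo_sub_holevo]
      have h1 : coherentInfo N Nc ξ.avg ≤ coherentInfo N Nc ρ := hmax ⟨ξ.isDensity_avg, hξ⟩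
      have h2 : 0 ≤ ∑ x, ξ.p x * coherentInfo N Nc (ξ.state x) :=
        Finset.sum_nonneg fun x _ => mul_nonneg (ξ.p_nonneg x) (hnonneg _ (ξ.isDensity x))
      linarith
  have heq : privateCapacityPower N Nc H B = coherentInfo N Nc ρ := hgreatest.csSup_eq
  rw [heq]
  exact ⟨hgreatest, ρ, hρ, rfl, fun ρ' hρ' => hmax hρ'⟩

/-- The private capacity-power function of a degradable channel is concave. -/
theorem concaveOn_privateCapacityPower (hN : IsChannel N) (hNc : IsComplementary N Nc)
    (hdeg : IsDegradable N Nc) (H : Matrix b b ℂ) {I : Set ℝ} (hI : Convex ℝ I)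
    (hsub : I ⊆ feasible N H) : ConcaveOn ℝ I (privateCapacityPower N Nc H) := by
  refine ⟨hI, fun x hx y hy s t hs ht hst => ?_⟩
  obtain ⟨-, ρ, hρ, eρ, -⟩ := privateCapacityPower_spec hN hNc hdeg H (hsub hx)
  obtain ⟨-, τ, hτ, eτ, -⟩ := privateCapacityPower_spec hN hNc hdeg H (hsub hy)
  obtain ⟨-, -, -, -, hle⟩ :=
    privateCapacityPower_spec hN hNc hdeg H (hsub (hI hx hy hs ht hst))
  have hp : ∀ i, 0 ≤ (![s, t] : Fin 2 → ℝ) i := by simp [Fin.forall_fin_two, hs, ht]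
  have hsum : ∑ i, (![s, t] : Fin 2 → ℝ) i = 1 := by simpa using hst
  have hd : ∀ i, IsDensity ((![ρ, τ] : Fin 2 → Matrix a a ℂ) i) := by
    simp [Fin.forall_fin_two, hρ.1, hτ.1]
  have hcon := hdeg.coherentInfo_concave hN hp hsum hd
  have hden := IsDensity.sum_smul hp hsum hd
  simp only [Fin.sum_univ_two, Matrix.cons_val_zero, Matrix.cons_val_one] at hcon hden
  rw [eρ, eτ]
  -- Energy is linear in the state, so the mixture of the two optimizers is admissible at the mixed
  -- threshold.
  refine hcon.trans (hle _ ⟨hden, ?_⟩)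
  have h1 := mul_le_mul_of_nonneg_left hρ.2 hs
  have h2 := mul_le_mul_of_nonneg_left hτ.2 ht
  simp only [smul_eq_mul, map_add, map_smul, mul_add, mul_smul_comm, trace_add, trace_smul,
    Complex.add_re, Complex.re_ofReal_mul]
  linarith

end CoherentInformation

end CapacityPower

theorem theorem5 {a b e : Type*} [Fintype a] [DecidableEq a] [Fintype b] [DecidableEq b]
    [Fintype e] [DecidableEq e]
    (N : Matrix a a ℂ →ₗ[ℂ] Matrix b b ℂ) (Nc : Matrix a a ℂ →ₗ[ℂ] Matrix e e ℂ)
    (hN : CapacityPower.IsChannel N) (hNc : CapacityPower.IsComplementary N Nc)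
    (hdeg : CapacityPower.IsDegradable N Nc)
    (H : Matrix b b ℂ) (hH : H.IsHermitian) :
    (∀ B ∈ CapacityPower.feasible N H,
      IsGreatest (CapacityPower.privateRates N Nc H B)
        (CapacityPower.privateCapacityPower N Nc H B)) ∧
    CapacityPower.PiecewiseConcaveOn (CapacityPower.feasible N H)
      (CapacityPower.privateCapacityPower N Nc H) := by
  -- The breakpoint set is empty.
  refine ⟨fun B hB => (CapacityPower.privateCapacityPower_spec hN hNc hdeg H hB).1, ∅, ?_⟩
  intro I hI hconn _
  exact CapacityPower.concaveOn_privateCapacityPower hN hNc hdeg H hconn.convex hI
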